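/- Let $r,s\in\mathbb C^*$ be such that $r^ms^n=1$ with $m,n\in\mathbb Z$ implies $m=n=0$. Let $U=U^+_{r,s}(B_2)$ be the unital associative $\mathbb C$-algebra generated by $e_1,e_2$ subject to $$e_1^2e_2-(r^2+s^2)e_1e_2e_1+r^2s^2e_2e_1^2=0,$$ $$e_1e_2^3-(r^2+rs+s^2)e_2e_1e_2^2+rs(r^2+rs+s^2)e_2^2e_1e_2-r^3s^3e_2^3e_1=0.$$ Put $X_1=e_1$, $X_2=e_1e_2-r^2e_2e_1$, $X_3=e_2X_2-s^{-2}X_2e_2$, $X_4=e_2$. For $t\in U$ let $\mathrm{ad}_t(x)=tx-xt$. Let $\mathrm{Der}(U)$ be the space of $\mathbb C$-linear derivations of $U$, $\mathrm{InnDer}(U)=\{\mathrm{ad}_t: t\in U\}$, and $HH^1(U)=\mathrm{Der}(U)/\mathrm{InnDer}(U)$. Let $D_1,D_2$ be the derivations of $U$ with $D_1(e_1)=e_1$, $D_1(e_2)=0$, $D_2(e_1)=0$, $D_2(e_2)=e_2$. They satisfy $$D_1(X_1)=X_1,\quad D_1(X_2)=X_2,\quad D_1(X_3)=X_3,\quad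 D_1(X_4)=0,$$ $$D_2(X_1)=0,\quad D_2(X_2)=X_2,\quad D_2(X_3)=2X_3,\quad D_2(X_4)=X_4.$$ Then: (1) Every derivation $D$ of $U$ can be written as $D=\mathrm{ad}_t+\mu_1D_1+\mu_2D_2$ with $t\in U$ and $\mu_1,\mu_2\in\mathbb C$, and the inner derivation $\mathrm{ad}_t\in\mathrm{InnDer}(U)$ and the scalars $\mu_1,\mu_2$ are uniquely determined by $D$. (2) $HH^1(U)$ is a two-dimensional vector space over $\mathbb C$, spanned by the classes of $D_1$ and $D_2$. -/

import Mathlib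

section Hochschild

variable (K : Type*) [Field K] (A : Type*) [Ring A] [Algebra K A]

/-- The space of `K`-linear derivations of a (not necessarily commutative) `K`-algebra `A`:
linear endomorphisms `D` with `D (a b) = D a b + a D b`. -/
def Der : Submodule K (A →ₗ[K] A) where
  carrier := {D | ∀ a b : A, D (a * b) = D a * b + a * D b}
  add_mem' := by
    intro D E hD hE a b
    simp only [LinearMap.add_apply, hD a b, hE a b, add_mul, mul_add]
    abel
  zero_mem' := by
    intro a b
    simp
  smul_mem' := by
    intro c D hD a b
    simp only [LinearMap.smul_apply, hD a b, smul_add, smul_mul_assoc, mul_smul_comm]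

/-- The additive group structure that `Der K A` has as a submodule (a shortcut for type class
search). -/
noncomputable instance Der.instAddCommGroup : AddCommGroup (Der K A) :=
  Submodule.addCommGroup (Der K A)

/-- The inner derivation `ad t : x ↦ t x - x t`, as a linear function of `t`. -/
noncomputable def ad : A →ₗ[K] Der K A where
  toFun t := ⟨LinearMap.mulLeft K t - LinearMap.mulRight K t, by
    intro a b
    simp only [LinearMap.sub_apply, LinearMap.mulLeft_apply, LinearMap.mulRight_apply]
    noncomm_ring⟩
  map_add' t u := by
    ext x
    simp only [Submodule.coe_add, LinearMap.sub_apply, LinearMap.add_apply,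
      LinearMap.mulLeft_apply, LinearMap.mulRight_apply]
    noncomm_ring
  map_smul' c t := by
    ext x
    simp [smul_sub]

/-- The space of inner derivations `ad t`, `t ∈ A`. -/
noncomputable def InnDer : Submodule K (Der K A) := LinearMap.range (ad K A)

/-- The first Hochschild cohomology `Der A / InnDer A`, as a `K`-vector space. -/
abbrev HH1 : Type _ := Der K A ⧸ InnDer K A

end Hochschild

namespace UPlusB2

/-- The two defining relations of `U⁺_{r,s}(B₂)` in the free algebra on `e₁ = ι 0`, `e₂ = ι 1`. -/
inductive Rel (r s : ℂ) : FreeAlgebra ℂ (Fin 2) → FreeAlgebra ℂ (Fin 2) → Prop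
  | serre1 (x y : FreeAlgebra ℂ (Fin 2))
      (hx : x = FreeAlgebra.ι ℂ 0) (hy : y = FreeAlgebra.ι ℂ 1) :
      Rel r s (x ^ 2 * y - (r ^ 2 + s ^ 2) • (x * y * x) + (r ^ 2 * s ^ 2) • (y * x ^ 2)) 0
  | serre2 (x y : FreeAlgebra ℂ (Fin 2))
      (hx : x = FreeAlgebra.ι ℂ 0) (hy : y = FreeAlgebra.ι ℂ 1) :
      Rel r s (x * y ^ 3 - (r ^ 2 + r * s + s ^ 2) • (y * x * y ^ 2)
        + (r * s * (r ^ 2 + r * s + s ^ 2)) • (y ^ 2 * x * y) - (r ^ 3 * s ^ 3) • (y ^ 3 * x)) 0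

/-- The algebra `U⁺_{r,s}(B₂)`. -/
abbrev U (r s : ℂ) : Type := RingQuot (Rel r s)

variable (r s : ℂ)

/-- The generator `e₁`. -/
noncomputable def e1 : U r s := RingQuot.mkAlgHom ℂ (Rel r s) (FreeAlgebra.ι ℂ 0)

/-- The generator `e₂`. -/
noncomputable def e2 : U r s := RingQuot.mkAlgHom ℂ (Rel r s) (FreeAlgebra.ι ℂ 1)

theorem rel1 : e1 r s ^ 2 * e2 r s - (r ^ 2 + s ^ 2) • (e1 r s * e2 r s * e1 r s)
    + (r ^ 2 * s ^ 2) • (e2 r s * e1 r s ^ 2) = 0 := by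
  have h := RingQuot.mkAlgHom_rel ℂ (Rel.serre1 (r := r) (s := s) _ _ rfl rfl)
  simp only [map_add, map_sub, map_smul, map_mul, map_pow, map_zero] at h
  exact h

theorem rel2 : e1 r s * e2 r s ^ 3
    - (r ^ 2 + r * s + s ^ 2) • (e2 r s * e1 r s * e2 r s ^ 2)
    + (r * s * (r ^ 2 + r * s + s ^ 2)) • (e2 r s ^ 2 * e1 r s * e2 r s)
    - (r ^ 3 * s ^ 3) • (e2 r s ^ 3 * e1 r s) = 0 := by
  have h := RingQuot.mkAlgHom_rel ℂ (Rel.serre2 (r := r) (s := s) _ _ rfl rfl)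
  simp only [map_add, map_sub, map_smul, map_mul, map_pow, map_zero] at h
  exact h

/-- `X₁ = e₁`. -/
noncomputable def X1 : U r s := e1 r s

/-- `X₂ = e₁ e₂ - r² e₂ e₁`. -/
noncomputable def X2 : U r s := e1 r s * e2 r s - r ^ 2 • (e2 r s * e1 r s)

/-- `X₃ = e₂ X₂ - s⁻² X₂ e₂`. -/
noncomputable def X3 : U r s := e2 r s * X2 r s - (s ^ 2)⁻¹ • (X2 r s * e2 r s)

/-- `X₄ = e₂`. -/
noncomputable def X4 : U r s := e2 r s

/-- The algebra homomorphism `U → U ⊕ ε U` (`ε² = 0`, `ε` central) with `e₁ ↦ e₁ + ε a e₁` and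
`e₂ ↦ e₂ + ε b e₂`. -/
noncomputable def diagHom (a b : ℂ) : U r s →ₐ[ℂ] TrivSqZeroExt (U r s) (U r s) :=
  RingQuot.liftAlgHom ℂ ⟨FreeAlgebra.lift ℂ
    ![TrivSqZeroExt.inl (e1 r s) + TrivSqZeroExt.inr (a • e1 r s),
      TrivSqZeroExt.inl (e2 r s) + TrivSqZeroExt.inr (b • e2 r s)], by
    rintro _ _ (⟨x, y, rfl, rfl⟩ | ⟨x, y, rfl, rfl⟩)
    · have h := rel1 r s
      ext
      · simpa using h
      · simp [pow_succ, mul_assoc, add_mul, mul_add] at h ⊢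
        linear_combination (norm := module) (2 * a + b) • h
    · have h := rel2 r s
      ext
      · simpa using h
      · simp [pow_succ, mul_assoc, add_mul, mul_add] at h ⊢
        linear_combination (norm := module) (a + 3 * b) • h⟩

theorem diagHom_e1 (a b : ℂ) : diagHom r s a b (e1 r s) =
    TrivSqZeroExt.inl (e1 r s) + TrivSqZeroExt.inr (a • e1 r s) := by
  simp [diagHom, e1]

theorem diagHom_e2 (a b : ℂ) : diagHom r s a b (e2 r s) =
    TrivSqZeroExt.inl (e2 r s) + TrivSqZeroExt.inr (b • e2 r s) := by
  simp [diagHom, e2]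

theorem fst_diagHom (a b : ℂ) (x : U r s) : (diagHom r s a b x).fst = x := by
  have h : (TrivSqZeroExt.fstHom ℂ (U r s) (U r s)).comp (diagHom r s a b)
      = AlgHom.id ℂ (U r s) := by
    apply RingQuot.ringQuot_ext'
    ext i
    fin_cases i
    · have := congrArg TrivSqZeroExt.fst (diagHom_e1 r s a b)
      simpa [e1] using this
    · have := congrArg TrivSqZeroExt.fst (diagHom_e2 r s a b)
      simpa [e2] using this
  exact DFunLike.congr_fun h x

/-- The derivation of `U` with `e₁ ↦ a e₁` and `e₂ ↦ b e₂`: the `ε`-component of `diagHom`. -/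
noncomputable def diagDer (a b : ℂ) : Der ℂ (U r s) :=
  ⟨(TrivSqZeroExt.sndHom (U r s) (U r s)).restrictScalars ℂ ∘ₗ (diagHom r s a b).toLinearMap, by
    intro x y
    simp [fst_diagHom]
    abel⟩

theorem diagDer_apply (a b : ℂ) (x : U r s) :
    (diagDer r s a b).1 x = (diagHom r s a b x).snd := rfl

theorem diagDer_mul (a b : ℂ) (x y : U r s) : (diagDer r s a b).1 (x * y) =
    (diagDer r s a b).1 x * y + x * (diagDer r s a b).1 y := (diagDer r s a b).2 x y

theorem diagDer_X1 (a b : ℂ) : (diagDer r s a b).1 (X1 r s) = a • X1 r s := by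
  simp [diagDer_apply, X1, diagHom_e1]

theorem diagDer_X4 (a b : ℂ) : (diagDer r s a b).1 (X4 r s) = b • X4 r s := by
  simp [diagDer_apply, X4, diagHom_e2]

theorem diagDer_X2 (a b : ℂ) : (diagDer r s a b).1 (X2 r s) = (a + b) • X2 r s := by
  have h1 := diagDer_X1 r s a b
  have h4 := diagDer_X4 r s a b
  rw [X1] at h1
  rw [X4] at h4
  simp only [X2, map_sub, map_smul, diagDer_mul, h1, h4, smul_mul_assoc, mul_smul_comm]
  module

theorem diagDer_X3 (a b : ℂ) : (diagDer r s a b).1 (X3 r s) = (a + 2 * b) • X3 r s := by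
  have h2 := diagDer_X2 r s a b
  have h4 := diagDer_X4 r s a b
  rw [X4] at h4
  simp only [X3, map_sub, map_smul, diagDer_mul, h2, h4, smul_mul_assoc, mul_smul_comm]
  module

/-- The derivation `D₁` : `X₁ ↦ X₁`, `X₂ ↦ X₂`, `X₃ ↦ X₃`, `X₄ ↦ 0`. -/
noncomputable def D1 : Der ℂ (U r s) := diagDer r s 1 0

/-- The derivation `D₂` : `X₁ ↦ 0`, `X₂ ↦ X₂`, `X₃ ↦ 2 X₃`, `X₄ ↦ X₄`. -/
noncomputable def D2 : Der ℂ (U r s) := diagDer r s 0 1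

end UPlusB2

/-! The algebra is a filtered deformation of a quantum affine space. Two of the generators `X1`, …,
`X4` commute up to a monomial in `r` and `s`, plus at most a multiple of a third generator. Giving
all four generators degree one, the ordered monomials form a basis, and only the scalars `lam`
survive in top degree.

For the basis, the operators `op1`, …, `op4` write down left multiplication on formal ordered
monomials. They satisfy the defining relations, so `rep` exists, and acting on the empty monomial
inverts the map `psi` (`co`).

Let a derivation send every generator into degree at most `n + 1`, and apply it to the commutation
relations. In top degree this says two things. A monomial of `D Xᵢ` that is not divisible by `Xᵢ`
has coefficient zero (`co_der_eq_zero`). The other coefficients satisfy a cocycle identity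
(`co_der_compat`), which makes them the leading coefficients of a single commutator `[t, ·]`. Both
need the independence of `r` and `s`: no nontrivial monomial is central up to lower terms, and no
monomial prime to `Xᵢ` imitates the commutation of `Xᵢ` with the other generators. Subtracting `ad
t` lowers the degree (`exists_ad_lower`), down to degree one.

There `D Xᵢ = mᵢ Xᵢ + cᵢ`, and the formula for `X2` in terms of `X1` and `X4` kills `c₁` and `c₄`.
What remains is a combination of `D1` and `D2`. Its scalars are unique because homomorphisms to a
commutative ring annihilate inner derivations (`diag_coeff_eq_zero`). -/

namespace UPlusB2

/-! ### Commutation relations of the four generators. -/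

section Relations

variable {r s : ℂ}

theorem X1_mul_X2 : X1 r s * X2 r s = s ^ 2 • (X2 r s * X1 r s) := by
  have h := rel1 r s
  rw [← sub_eq_zero, ← h]
  simp only [X1, X2, mul_sub, sub_mul, mul_smul_comm, smul_mul_assoc, pow_two, mul_assoc]
  module

theorem X1_mul_X4 : X1 r s * X4 r s = r ^ 2 • (X4 r s * X1 r s) + X2 r s := by
  simp only [X1, X2, X4]
  module

theorem X4_mul_X2 : X4 r s * X2 r s = (s ^ 2)⁻¹ • (X2 r s * X4 r s) + X3 r s := by
  simp only [X3, X4]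
  module

theorem X2_mul_X4 (hs : s ≠ 0) :
    X2 r s * X4 r s = s ^ 2 • (X4 r s * X2 r s) - s ^ 2 • X3 r s := by
  rw [X4_mul_X2, smul_add, smul_smul, mul_inv_cancel₀ (pow_ne_zero 2 hs)]
  module

/-- Expanded in `e1` and `e2`, the difference of the two sides is `-s⁻²` times the second Serre
relation. -/
theorem X3_mul_X4 (hs : s ≠ 0) : X3 r s * X4 r s = (r * s) • (X4 r s * X3 r s) := by
  have h := rel2 r s
  have h' : X3 r s * X4 r s - (r * s) • (X4 r s * X3 r s) = (-(s ^ 2)⁻¹ : ℂ) • (0 : U r s) := by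
    rw [← h]
    simp only [X2, X3, X4, mul_sub, sub_mul, mul_smul_comm, smul_mul_assoc, pow_succ, pow_zero,
      one_mul, mul_assoc, smul_sub, smul_add, smul_smul]
    match_scalars <;> field_simp <;> ring
  rw [smul_zero, sub_eq_zero] at h'
  exact h'

theorem X1_mul_X3 (hs : s ≠ 0) : X1 r s * X3 r s = (r ^ 2 * s ^ 2) • (X3 r s * X1 r s) := by
  have h3 : X3 r s = X4 r s * X2 r s - (s ^ 2)⁻¹ • (X2 r s * X4 r s) := rfl
  calc X1 r s * X3 r s
      = (X1 r s * X4 r s) * X2 r s - (s ^ 2)⁻¹ • ((X1 r s * X2 r s) * X4 r s) := by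
        rw [h3]; simp only [mul_sub, mul_smul_comm, mul_assoc]
    _ = r ^ 2 • (X4 r s * (X1 r s * X2 r s)) + X2 r s * X2 r s - X2 r s * (X1 r s * X4 r s) := by
        rw [X1_mul_X4, X1_mul_X2]
        simp only [add_mul, smul_mul_assoc, smul_smul, mul_assoc,
          inv_mul_cancel₀ (pow_ne_zero 2 hs), one_smul, X1_mul_X4, X1_mul_X2]
    -- The two terms `X2 * X2` cancel, so no lower term is left.
    _ = (r ^ 2 * s ^ 2) • (X3 r s * X1 r s) := by
        rw [X1_mul_X4, X1_mul_X2, h3]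
        simp only [mul_add, sub_mul, mul_smul_comm, smul_mul_assoc, mul_assoc]
        match_scalars <;> field_simp
        ring

/-- Forced by associativity: reordering `X1 * X3 * X4` from either end, the terms in `X4 * X3 * X1`
agree, and comparing the rest gives the relation multiplied by `r * s`. -/
theorem X2_mul_X3 (hr : r ≠ 0) (hs : s ≠ 0) :
    X2 r s * X3 r s = (r * s) • (X3 r s * X2 r s) := by
  have h1 : X1 r s * (X3 r s * X4 r s) = (X1 r s * X3 r s) * X4 r s := (mul_assoc _ _ _).symm
  rw [X3_mul_X4 hs, X1_mul_X3 hs, mul_smul_comm, ← mul_assoc, X1_mul_X4, smul_mul_assoc,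
    mul_assoc (X3 r s), X1_mul_X4, add_mul, smul_mul_assoc, mul_assoc (X4 r s), X1_mul_X3 hs,
    mul_add, mul_smul_comm, mul_smul_comm, ← mul_assoc, ← mul_assoc (X3 r s), X3_mul_X4 hs] at h1
  have h2 : (r * s) • (X2 r s * X3 r s) = (r * s) • ((r * s) • (X3 r s * X2 r s)) := by
    simp only [smul_mul_assoc, smul_add] at h1
    linear_combination (norm := module) h1
  exact smul_right_injective _ (mul_ne_zero hr hs) h2

end Relations

/-- The relations between `X₁, …, X₄` imply the defining relations of `U`. -/
theorem serre_of_commutation {A : Type*} [Ring A] [Algebra ℂ A] {r s : ℂ} (hs : s ≠ 0)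
    {x y z w : A} (hxz : x * z = s ^ 2 • (z * x)) (hxy : x * y = r ^ 2 • (y * x) + z)
    (hzy : z * y = s ^ 2 • (y * z) - s ^ 2 • w) (hwy : w * y = (r * s) • (y * w)) :
    x ^ 2 * y - (r ^ 2 + s ^ 2) • (x * y * x) + (r ^ 2 * s ^ 2) • (y * x ^ 2) = 0 ∧
    x * y ^ 3 - (r ^ 2 + r * s + s ^ 2) • (y * x * y ^ 2)
      + (r * s * (r ^ 2 + r * s + s ^ 2)) • (y ^ 2 * x * y) - (r ^ 3 * s ^ 3) • (y ^ 3 * x) = 0 := by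
  -- Two of the hypotheses merely define `z` and `w`; the other two then become the Serre relations,
  -- up to a scalar.
  obtain rfl : z = x * y - r ^ 2 • (y * x) := by rw [hxy]; module
  obtain rfl : w = y * (x * y - r ^ 2 • (y * x))
      - (s ^ 2)⁻¹ • ((x * y - r ^ 2 • (y * x)) * y) := by
    rw [hzy]
    match_scalars <;> field_simp
    ring
  constructor
  · rw [← sub_eq_zero] at hxz
    rw [← hxz]
    simp only [mul_sub, sub_mul, mul_smul_comm, smul_mul_assoc, pow_two, mul_assoc]
    module
  · rw [← sub_eq_zero] at hwy
    rw [← smul_zero (-s ^ 2), ← hwy]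
    simp only [mul_sub, sub_mul, mul_smul_comm, smul_mul_assoc, pow_succ, pow_zero,
      one_mul, mul_assoc, smul_sub, smul_smul]
    match_scalars <;> field_simp <;> ring

/-! ### The representation on formal ordered monomials. -/

section PBW

/-- The space with basis the exponents of the ordered monomials. -/
abbrev V : Type := (Fin 4 → ℕ) →₀ ℂ

/-- The basis vector with the given exponents. -/
noncomputable abbrev vec (a b c d : ℕ) : V := Finsupp.single ![a, b, c, d] 1

/-- The linear operator on `V` with the given values on basis vectors. -/
noncomputable def op (f : ℕ → ℕ → ℕ → ℕ → V) : Module.End ℂ V :=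
  Finsupp.linearCombination ℂ fun b => f (b 0) (b 1) (b 2) (b 3)

theorem op_vec (f : ℕ → ℕ → ℕ → ℕ → V) (a b c d : ℕ) : op f (vec a b c d) = f a b c d := by
  simp [op]

theorem end_ext {W : Type*} [AddCommMonoid W] [Module ℂ W] {f g : V →ₗ[ℂ] W}
    (h : ∀ a b c d, f (vec a b c d) = g (vec a b c d)) : f = g := by
  refine Finsupp.lhom_ext' fun b => LinearMap.ext_ring ?_
  have hb : b = ![b 0, b 1, b 2, b 3] := by
    ext i; fin_cases i <;> rfl
  rw [hb]
  exact h _ _ _ _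

variable (r s : ℂ)

/-- The coefficients `γ a` of `X₄ X₁ᵃ = r⁻²ᵃ X₁ᵃ X₄ + γ a X₁ᵃ⁻¹ X₂`. -/
noncomputable def coeff41 : ℕ → ℂ
  | 0 => 0
  | a + 1 => (s ^ 2)⁻¹ * coeff41 a - (r ^ (2 * (a + 1)))⁻¹

/-- The coefficients `γ b` of `X₄ X₂ᵇ = s⁻²ᵇ X₂ᵇ X₄ + γ b X₂ᵇ⁻¹ X₃`. -/
noncomputable def coeff42 : ℕ → ℂ
  | 0 => 0
  | b + 1 => (r * s)⁻¹ * coeff42 b + (s ^ (2 * b))⁻¹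

/-- The defining recursion splits the last factor off `X₁ᵃ⁺¹`; this one splits off the first, as is
needed when composing with `op1`. The same holds for `coeff42_succ'` and `op2`. -/
theorem coeff41_succ' (hr : r ≠ 0) (hs : s ≠ 0) (a : ℕ) : coeff41 r s (a + 1) =
    (r ^ 2)⁻¹ * coeff41 r s a - (r ^ 2)⁻¹ * (s ^ (2 * a))⁻¹ := by
  induction a with
  | zero => simp [coeff41]
  | succ a ih =>
    rw [coeff41, ih]
    rw [coeff41] at ih
    linear_combination (norm := skip) (r ^ 2)⁻¹ * ih
    field_simp
    ring

theorem coeff42_succ' (hr : r ≠ 0) (hs : s ≠ 0) (b : ℕ) : coeff42 r s (b + 1) =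
    (s ^ 2)⁻¹ * coeff42 r s b + (r ^ b * s ^ b)⁻¹ := by
  induction b with
  | zero => simp [coeff42]
  | succ b ih =>
    rw [coeff42, ih]
    rw [coeff42] at ih
    linear_combination (norm := skip) (s ^ 2)⁻¹ * ih
    field_simp
    ring

/-- Left multiplication by `X₁` on ordered monomials. -/
noncomputable def op1 : Module.End ℂ V := op fun a b c d => vec (a + 1) b c d

/-- Left multiplication by `X₂` on ordered monomials. -/
noncomputable def op2 : Module.End ℂ V :=
  op fun a b c d => (s ^ (2 * a))⁻¹ • vec a (b + 1) c d

/-- Left multiplication by `X₃` on ordered monomials. -/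
noncomputable def op3 : Module.End ℂ V :=
  op fun a b c d => ((r ^ (2 * a) * s ^ (2 * a))⁻¹ * (r ^ b * s ^ b)⁻¹) • vec a b (c + 1) d

/-- Left multiplication by `X₄` on ordered monomials. -/
noncomputable def op4 : Module.End ℂ V :=
  op fun a b c d => ((r ^ (2 * a))⁻¹ * (s ^ (2 * b))⁻¹ * (r ^ c * s ^ c)⁻¹) • vec a b c (d + 1)
    + ((r ^ (2 * a))⁻¹ * coeff42 r s b) • vec a (b - 1) (c + 1) d
    + coeff41 r s a • vec (a - 1) (b + 1) c d

variable {r s}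

theorem op1_mul_op2 (hs : s ≠ 0) : op1 * op2 s = s ^ 2 • (op2 s * op1) := by
  refine end_ext fun a b c d => ?_
  simp only [Module.End.mul_apply, LinearMap.smul_apply, op1, op2, op_vec, map_smul, smul_smul]
  congr 1
  field_simp
  ring

theorem op1_mul_op4 (hr : r ≠ 0) (hs : s ≠ 0) :
    op1 * op4 r s = r ^ 2 • (op4 r s * op1) + op2 s := by
  refine end_ext fun a b c d => ?_
  simp only [Module.End.mul_apply, LinearMap.smul_apply, LinearMap.add_apply, op1, op2, op4,
    op_vec, map_smul, map_add, Nat.add_sub_cancel, coeff41_succ' r s hr hs]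
  -- The exponent `a - 1` truncates at `a = 0`, where its coefficient vanishes.
  rcases a with _ | a
  · simp only [coeff41, zero_add]
    match_scalars <;> field_simp <;> ring
  · simp only [Nat.add_sub_cancel]
    match_scalars <;> field_simp <;> ring

theorem op2_mul_op4 (hr : r ≠ 0) (hs : s ≠ 0) :
    op2 s * op4 r s = s ^ 2 • (op4 r s * op2 s) - s ^ 2 • op3 r s := by
  refine end_ext fun a b c d => ?_
  simp only [Module.End.mul_apply, LinearMap.smul_apply, LinearMap.sub_apply, op2, op3, op4,
    op_vec, map_smul, map_add, Nat.add_sub_cancel, coeff42_succ' r s hr hs]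
  rcases a with _ | a <;> rcases b with _ | b <;>
    simp only [coeff41, coeff42, zero_add, Nat.add_sub_cancel] <;>
    match_scalars <;> field_simp <;> ring

theorem op3_mul_op4 (hr : r ≠ 0) (hs : s ≠ 0) :
    op3 r s * op4 r s = (r * s) • (op4 r s * op3 r s) := by
  refine end_ext fun a b c d => ?_
  simp only [Module.End.mul_apply, LinearMap.smul_apply, op3, op4,
    op_vec, map_smul, map_add]
  rcases a with _ | a <;> rcases b with _ | b <;>
    simp only [coeff41, coeff42, Nat.add_sub_cancel] <;>
    match_scalars <;> field_simp <;> ring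

/-- The representation of `U` on `V` by left multiplication on ordered monomials. -/
noncomputable def rep (hr : r ≠ 0) (hs : s ≠ 0) : U r s →ₐ[ℂ] Module.End ℂ V :=
  RingQuot.liftAlgHom ℂ ⟨FreeAlgebra.lift ℂ ![op1, op4 r s], by
    have h := serre_of_commutation (A := Module.End ℂ V) (r := r) (s := s) hs (op1_mul_op2 hs) (op1_mul_op4 hr hs) (op2_mul_op4 hr hs)
      (op3_mul_op4 hr hs)
    rintro _ _ (⟨x, y, rfl, rfl⟩ | ⟨x, y, rfl, rfl⟩)
    · simpa using h.1
    · simpa using h.2⟩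

theorem rep_e1 (hr : r ≠ 0) (hs : s ≠ 0) : rep hr hs (e1 r s) = op1 := by
  simp [rep, e1]

theorem rep_e2 (hr : r ≠ 0) (hs : s ≠ 0) : rep hr hs (e2 r s) = op4 r s := by
  simp [rep, e2]

end PBW

theorem U_induction {r s : ℂ} {P : U r s → Prop} (algebraMap : ∀ c, P (algebraMap ℂ (U r s) c))
    (e1 : P (e1 r s)) (e2 : P (e2 r s)) (mul : ∀ u v, P u → P v → P (u * v))
    (add : ∀ u v, P u → P v → P (u + v)) (u : U r s) : P u := by
  obtain ⟨x, rfl⟩ := RingQuot.mkAlgHom_surjective ℂ (Rel r s) u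
  induction x using FreeAlgebra.induction with
  | grade0 c => simpa using algebraMap c
  | grade1 i => fin_cases i <;> assumption
  | mul a b ha hb => simpa using mul _ _ ha hb
  | add a b ha hb => simpa using add _ _ ha hb

/-! ### The ordered monomials form a basis. -/

section PBW

variable (r s : ℂ)

/-- The PBW generators as a family. -/
noncomputable def X : Fin 4 → U r s := ![X1 r s, X2 r s, X3 r s, X4 r s]

/-- The ordered monomials in the PBW generators. -/
noncomputable def mono (b : Fin 4 → ℕ) : U r s :=
  X1 r s ^ b 0 * (X2 r s ^ b 1 * (X3 r s ^ b 2 * X4 r s ^ b 3))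

/-- The linear map sending basis vectors to ordered monomials. -/
noncomputable def psi : V →ₗ[ℂ] U r s := Finsupp.linearCombination ℂ (mono r s)

theorem psi_vec (a b c d : ℕ) : psi r s (vec a b c d) =
    X1 r s ^ a * (X2 r s ^ b * (X3 r s ^ c * X4 r s ^ d)) := by
  simp [psi, mono]

variable {r s}

theorem mul_pow_of_mul {A : Type*} [Ring A] [Algebra ℂ A] {x y : A} {c : ℂ}
    (h : x * y = c • (y * x)) (n : ℕ) : x * y ^ n = c ^ n • (y ^ n * x) := by
  induction n with
  | zero => simp
  | succ n ih =>
    rw [pow_succ, ← mul_assoc, ih, smul_mul_assoc, mul_assoc, h, mul_smul_comm, smul_smul,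
      pow_succ, mul_assoc]

theorem mul_swap {A : Type*} [Ring A] [Algebra ℂ A] {x y : A} {c : ℂ} (hc : c ≠ 0)
    (h : x * y = c • (y * x)) : y * x = c⁻¹ • (x * y) := by
  rw [h, smul_smul, inv_mul_cancel₀ hc, one_smul]

theorem X2_mul_X1_pow (hs : s ≠ 0) (a : ℕ) :
    X2 r s * X1 r s ^ a = (s ^ (2 * a))⁻¹ • (X1 r s ^ a * X2 r s) := by
  rw [mul_pow_of_mul (mul_swap (pow_ne_zero 2 hs) X1_mul_X2), inv_pow, pow_mul]

theorem X3_mul_X1_pow (hr : r ≠ 0) (hs : s ≠ 0) (a : ℕ) :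
    X3 r s * X1 r s ^ a = (r ^ (2 * a) * s ^ (2 * a))⁻¹ • (X1 r s ^ a * X3 r s) := by
  rw [mul_pow_of_mul (mul_swap (mul_ne_zero (pow_ne_zero 2 hr) (pow_ne_zero 2 hs))
    (X1_mul_X3 hs)), inv_pow, mul_pow, pow_mul, pow_mul]

theorem X3_mul_X2_pow (hr : r ≠ 0) (hs : s ≠ 0) (b : ℕ) :
    X3 r s * X2 r s ^ b = (r ^ b * s ^ b)⁻¹ • (X2 r s ^ b * X3 r s) := by
  rw [mul_pow_of_mul (mul_swap (mul_ne_zero hr hs) (X2_mul_X3 hr hs)), inv_pow, mul_pow]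

theorem X4_mul_X3_pow (hr : r ≠ 0) (hs : s ≠ 0) (c : ℕ) :
    X4 r s * X3 r s ^ c = (r ^ c * s ^ c)⁻¹ • (X3 r s ^ c * X4 r s) := by
  rw [mul_pow_of_mul (mul_swap (mul_ne_zero hr hs) (X3_mul_X4 hs)), inv_pow, mul_pow]

theorem X4_mul_X1 (hr : r ≠ 0) :
    X4 r s * X1 r s = (r ^ 2)⁻¹ • (X1 r s * X4 r s) - (r ^ 2)⁻¹ • X2 r s := by
  rw [X1_mul_X4]
  match_scalars <;> field_simp
  ring

theorem X4_mul_X1_pow (hr : r ≠ 0) (hs : s ≠ 0) (a : ℕ) :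
    X4 r s * X1 r s ^ a = (r ^ (2 * a))⁻¹ • (X1 r s ^ a * X4 r s)
      + coeff41 r s a • (X1 r s ^ (a - 1) * X2 r s) := by
  induction a with
  | zero => simp [coeff41]
  | succ a ih =>
    rw [pow_succ, ← mul_assoc, ih, add_mul, smul_mul_assoc, smul_mul_assoc, mul_assoc, X4_mul_X1 hr,
      mul_assoc, mul_swap (pow_ne_zero 2 hs) X1_mul_X2, Nat.add_sub_cancel, coeff41]
    rcases a with _ | a
    · simp only [coeff41, pow_zero, one_mul]
      match_scalars <;> field_simp <;> ring
    · simp only [Nat.add_sub_cancel, mul_sub, mul_smul_comm, pow_succ, mul_assoc]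
      match_scalars <;> field_simp <;> ring

theorem X4_mul_X2_pow (hr : r ≠ 0) (hs : s ≠ 0) (b : ℕ) :
    X4 r s * X2 r s ^ b = (s ^ (2 * b))⁻¹ • (X2 r s ^ b * X4 r s)
      + coeff42 r s b • (X2 r s ^ (b - 1) * X3 r s) := by
  induction b with
  | zero => simp [coeff42]
  | succ b ih =>
    rw [pow_succ, ← mul_assoc, ih, add_mul, smul_mul_assoc, smul_mul_assoc, mul_assoc, X4_mul_X2,
      mul_assoc, mul_swap (mul_ne_zero hr hs) (X2_mul_X3 hr hs), Nat.add_sub_cancel, coeff42]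
    rcases b with _ | b
    · simp only [coeff42, pow_zero, one_mul]
      match_scalars <;> field_simp <;> ring
    · simp only [Nat.add_sub_cancel, mul_add, mul_smul_comm, pow_succ, mul_assoc]
      match_scalars <;> field_simp
      ring

theorem psi_op1 (v : V) : psi r s (op1 v) = X1 r s * psi r s v := by
  refine DFunLike.congr_fun (f := psi r s ∘ₗ op1) (g := LinearMap.mulLeft ℂ (X1 r s) ∘ₗ psi r s)
    (end_ext fun a b c d => ?_) v
  simp only [LinearMap.comp_apply, LinearMap.mulLeft_apply, op1, op_vec, psi_vec, pow_succ',
    mul_assoc]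

theorem psi_op2 (hs : s ≠ 0) (v : V) : psi r s (op2 s v) = X2 r s * psi r s v := by
  refine DFunLike.congr_fun (f := psi r s ∘ₗ op2 s)
    (g := LinearMap.mulLeft ℂ (X2 r s) ∘ₗ psi r s) (end_ext fun a b c d => ?_) v
  simp only [LinearMap.comp_apply, LinearMap.mulLeft_apply, op2, op_vec, psi_vec, map_smul]
  rw [← mul_assoc (X2 r s), X2_mul_X1_pow hs]
  simp only [pow_succ', mul_assoc, smul_mul_assoc]

theorem psi_op3 (hr : r ≠ 0) (hs : s ≠ 0) (v : V) :
    psi r s (op3 r s v) = X3 r s * psi r s v := by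
  refine DFunLike.congr_fun (f := psi r s ∘ₗ op3 r s)
    (g := LinearMap.mulLeft ℂ (X3 r s) ∘ₗ psi r s) (end_ext fun a b c d => ?_) v
  simp only [LinearMap.comp_apply, LinearMap.mulLeft_apply, op3, op_vec, psi_vec, map_smul]
  rw [← mul_assoc (X3 r s), X3_mul_X1_pow hr hs, smul_mul_assoc, mul_assoc, ← mul_assoc (X3 r s),
    X3_mul_X2_pow hr hs]
  simp only [pow_succ', mul_assoc, smul_mul_assoc, mul_smul_comm, smul_smul]

theorem psi_op4 (hr : r ≠ 0) (hs : s ≠ 0) (v : V) :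
    psi r s (op4 r s v) = X4 r s * psi r s v := by
  refine DFunLike.congr_fun (f := psi r s ∘ₗ op4 r s)
    (g := LinearMap.mulLeft ℂ (X4 r s) ∘ₗ psi r s) (end_ext fun a b c d => ?_) v
  simp only [LinearMap.comp_apply, LinearMap.mulLeft_apply, op4, op_vec, psi_vec, map_smul, map_add]
  rw [← mul_assoc (X4 r s), X4_mul_X1_pow hr hs, add_mul, smul_mul_assoc, smul_mul_assoc, mul_assoc _ (X4 r s),
    ← mul_assoc (X4 r s), X4_mul_X2_pow hr hs, add_mul, smul_mul_assoc, smul_mul_assoc, mul_assoc _ (X4 r s),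
    ← mul_assoc (X4 r s), X4_mul_X3_pow hr hs]
  simp only [pow_succ', mul_assoc, smul_mul_assoc, mul_smul_comm, smul_smul, mul_add, smul_add]

/-- Applied to the empty monomial, this intertwining property shows that `psi` is surjective, with
`u ↦ rep u (vec 0 0 0 0)` as a right inverse. -/
theorem psi_rep (hr : r ≠ 0) (hs : s ≠ 0) (u : U r s) (v : V) :
    psi r s (rep hr hs u v) = u * psi r s v := by
  induction u using U_induction generalizing v with
  | algebraMap c => simp [Algebra.algebraMap_eq_smul_one]
  | e1 => rw [rep_e1, psi_op1, X1]
  | e2 => rw [rep_e2, psi_op4 hr hs, X4]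
  | mul u w hu hw => rw [map_mul, Module.End.mul_apply, hu, hw, mul_assoc]
  | add u w hu hw => rw [map_add, LinearMap.add_apply, map_add, hu, hw, add_mul]

theorem rep_X2 (hr : r ≠ 0) (hs : s ≠ 0) : rep hr hs (X2 r s) = op2 s := by
  rw [X2, map_sub, map_smul, map_mul, map_mul, rep_e1, rep_e2, op1_mul_op4 hr hs]
  abel

theorem rep_X3 (hr : r ≠ 0) (hs : s ≠ 0) : rep hr hs (X3 r s) = op3 r s := by
  rw [X3, map_sub, map_smul, map_mul, map_mul, rep_X2, rep_e2, op2_mul_op4 hr hs]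
  match_scalars <;> field_simp
  ring

/-- The monomial is built from the right, so each operator acts where all exponents to its left are
zero; there its scalar is `1` and the correction terms of `op4` vanish. -/
theorem rep_mono (hr : r ≠ 0) (hs : s ≠ 0) (b : Fin 4 → ℕ) :
    rep hr hs (mono r s b) (vec 0 0 0 0) = Finsupp.single b 1 := by
  have h4 (d : ℕ) : (op4 r s ^ d) (vec 0 0 0 0) = vec 0 0 0 d := by
    induction d with
    | zero => rfl
    | succ d ih => rw [pow_succ', Module.End.mul_apply, ih, op4, op_vec]; simp [coeff41, coeff42]
  have h3 (c d : ℕ) : (op3 r s ^ c) (vec 0 0 0 d) = vec 0 0 c d := by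
    induction c with
    | zero => rfl
    | succ c ih => rw [pow_succ', Module.End.mul_apply, ih, op3, op_vec]; simp
  have h2 (b c d : ℕ) : (op2 s ^ b) (vec 0 0 c d) = vec 0 b c d := by
    induction b with
    | zero => rfl
    | succ b ih => rw [pow_succ', Module.End.mul_apply, ih, op2, op_vec]; simp
  have h1 (a b c d : ℕ) : (op1 ^ a) (vec 0 b c d) = vec a b c d := by
    induction a with
    | zero => rfl
    | succ a ih => rw [pow_succ', Module.End.mul_apply, ih, op1, op_vec]
  simp only [mono, map_mul, map_pow, Module.End.mul_apply]
  rw [X1, X4, rep_e1, rep_e2, rep_X2, rep_X3, h4, h3, h2, h1]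
  have hb : ![b 0, b 1, b 2, b 3] = b := by ext i; fin_cases i <;> rfl
  rw [vec, hb]

/-- The coordinates with respect to the PBW basis. -/
noncomputable def co (hr : r ≠ 0) (hs : s ≠ 0) : U r s ≃ₗ[ℂ] V where
  toFun u := rep hr hs u (vec 0 0 0 0)
  map_add' u v := by simp
  map_smul' c u := by simp
  invFun := psi r s
  left_inv u := by
    rw [psi_rep, psi_vec]
    simp
  right_inv v := by
    change rep hr hs (psi r s v) (vec 0 0 0 0) = v
    induction v using Finsupp.induction_linear with
    | zero => simp
    | add v w hv hw => rw [map_add, map_add, LinearMap.add_apply, hv, hw]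
    | single b c =>
      rw [psi, Finsupp.linearCombination_single, map_smul, LinearMap.smul_apply, rep_mono]
      simp

theorem co_mono (hr : r ≠ 0) (hs : s ≠ 0) (b : Fin 4 → ℕ) :
    co hr hs (mono r s b) = Finsupp.single b 1 := rep_mono hr hs b

theorem co_symm_apply (hr : r ≠ 0) (hs : s ≠ 0) (v : V) : (co hr hs).symm v = psi r s v := rfl

end PBW

/-! ### The degree filtration and the commutation factors. -/

section Filtration

variable (r s : ℂ)

/-- The total degree of an exponent vector. -/
abbrev deg (b : Fin 4 → ℕ) : ℕ := ∑ i, b i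

/-- The exponent vector of the `i`-th generator. -/
abbrev δ (i : Fin 4) : Fin 4 → ℕ := Pi.single i 1

theorem deg_add_δ (b : Fin 4 → ℕ) (i : Fin 4) : deg (b + δ i) = deg b + 1 := by
  simp [deg, Finset.sum_add_distrib]

/-- The span of the ordered monomials of total degree at most `n`. -/
noncomputable def F (n : ℕ) : Submodule ℂ (U r s) :=
  Submodule.span ℂ (mono r s '' {b | deg b ≤ n})

variable {r s}

theorem mono_mem {b : Fin 4 → ℕ} {n : ℕ} (h : deg b ≤ n) : mono r s b ∈ F r s n :=
  Submodule.subset_span ⟨b, h, rfl⟩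

theorem F_le {m n : ℕ} (h : m ≤ n) : F r s m ≤ F r s n :=
  Submodule.span_mono (Set.image_mono fun _ hb => le_trans hb h)

theorem F_induction {n : ℕ} {W : Submodule ℂ (U r s)}
    (h : ∀ b, deg b ≤ n → mono r s b ∈ W) : F r s n ≤ W := by
  rw [F, Submodule.span_le]
  rintro _ ⟨b, hb, rfl⟩
  exact h b hb

theorem mem_F_iff (hr : r ≠ 0) (hs : s ≠ 0) {n : ℕ} {u : U r s} :
    u ∈ F r s n ↔ ∀ b, n < deg b → co hr hs u b = 0 := by
  constructor
  · intro hu b hb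
    have : F r s n ≤ LinearMap.ker (Finsupp.lapply b ∘ₗ (co hr hs).toLinearMap) := by
      refine F_induction fun a ha => ?_
      have : a ≠ b := by rintro rfl; omega
      simp [co_mono, this]
    exact this hu
  · intro h
    rw [← (co hr hs).symm_apply_apply u, co_symm_apply, psi, Finsupp.linearCombination_apply]
    refine Submodule.sum_mem _ fun b hb => Submodule.smul_mem _ _ (mono_mem ?_)
    by_contra hb'
    exact Finsupp.mem_support_iff.1 hb (h b (not_le.1 hb'))

theorem exists_mem_F (hr : r ≠ 0) (hs : s ≠ 0) (u : U r s) : ∃ n, u ∈ F r s n := by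
  refine ⟨(co hr hs u).support.sup deg, (mem_F_iff hr hs).2 fun b hb => ?_⟩
  by_contra h
  exact absurd (Finset.le_sup (f := deg) (Finsupp.mem_support_iff.2 h)) (not_le.2 hb)

theorem mem_F_of_lead (hr : r ≠ 0) (hs : s ≠ 0) {n : ℕ} {u : U r s} (hu : u ∈ F r s (n + 1))
    (h : ∀ b, deg b = n + 1 → co hr hs u b = 0) : u ∈ F r s n := by
  refine (mem_F_iff hr hs).2 fun b hb => ?_
  rcases eq_or_ne (deg b) (n + 1) with h' | h'
  · exact h b h'
  · exact (mem_F_iff hr hs).1 hu b (by omega)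

variable (r s)

/-- The exponent of `r` in the commutation factors. -/
def expR : Fin 4 → Fin 4 → ℤ := ![![0, 0, 2, 2], ![0, 0, 1, 0], ![-2, -1, 0, 1], ![-2, 0, -1, 0]]

/-- The exponent of `s` in the commutation factors. -/
def expS : Fin 4 → Fin 4 → ℤ := ![![0, 2, 2, 0], ![-2, 0, 1, 2], ![-2, -1, 0, 1], ![0, -2, -1, 0]]

/-- The factor in `Xᵢ Xⱼ = lam i j Xⱼ Xᵢ + ⋯`. -/
noncomputable def lam (i j : Fin 4) : ℂ := r ^ expR i j * s ^ expS i j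

/-- The factor in `Xᵇ Xⱼ = chi j b Xⱼ Xᵇ + ⋯`. -/
noncomputable def chi (j : Fin 4) (b : Fin 4 → ℕ) : ℂ := ∏ l, lam r s l j ^ b l

/-- The factor in `Xⱼ Xᵇ = lc j b X^(b + δⱼ) + ⋯`. -/
noncomputable def lc (j : Fin 4) (b : Fin 4 → ℕ) : ℂ :=
  ∏ l, if l < j then lam r s j l ^ b l else 1

variable {r s}

theorem lam_ne_zero (hr : r ≠ 0) (hs : s ≠ 0) (i j : Fin 4) : lam r s i j ≠ 0 :=
  mul_ne_zero (zpow_ne_zero _ hr) (zpow_ne_zero _ hs)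

theorem lam_mul_lam (hr : r ≠ 0) (hs : s ≠ 0) (i j : Fin 4) : lam r s i j * lam r s j i = 1 := by
  have hR : expR j i = - expR i j := by revert i j; decide
  have hS : expS j i = - expS i j := by revert i j; decide
  rw [lam, lam, hR, hS, zpow_neg, zpow_neg]
  have := zpow_ne_zero (expR i j) hr
  have := zpow_ne_zero (expS i j) hs
  field_simp

theorem lam_self (i : Fin 4) : lam r s i i = 1 := by
  have hR : expR i i = 0 := by revert i; decide
  have hS : expS i i = 0 := by revert i; decide
  simp [lam, hR, hS]

theorem lc_ne_zero (hr : r ≠ 0) (hs : s ≠ 0) (j : Fin 4) (b : Fin 4 → ℕ) : lc r s j b ≠ 0 := by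
  refine Finset.prod_ne_zero_iff.2 fun l _ => ?_
  split_ifs
  · exact pow_ne_zero _ (lam_ne_zero hr hs _ _)
  · exact one_ne_zero

theorem chi_add_δ (i j : Fin 4) (b : Fin 4 → ℕ) :
    chi r s j (b + δ i) = chi r s j b * lam r s i j := by
  simp only [chi, Pi.add_apply, pow_add, Finset.prod_mul_distrib]
  congr 1
  rw [Finset.prod_eq_single i (by intro l _ hl; simp [hl]) (by simp)]
  simp

theorem lc_add_δ (i j : Fin 4) (b : Fin 4 → ℕ) :
    lc r s j (b + δ i) = lc r s j b * if i < j then lam r s j i else 1 := by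
  have : ∀ l, (if l < j then lam r s j l ^ (b + δ i) l else 1)
      = (if l < j then lam r s j l ^ b l else 1) *
        (if l < j then lam r s j l ^ δ i l else 1) := by
    intro l
    split_ifs <;> simp [pow_add]
  simp only [lc, this, Finset.prod_mul_distrib]
  congr 1
  rw [Finset.prod_eq_single i (by intro l _ hl; simp [hl]) (by simp)]
  simp

theorem psi_vec_eq_mono (a b c d : ℕ) : psi r s (vec a b c d) = mono r s ![a, b, c, d] := by
  simp [psi]

/-- Only `X4` produces corrections, and each of them replaces two generators by one. -/
theorem X_mul_mono (hr : r ≠ 0) (hs : s ≠ 0) (j : Fin 4) (b : Fin 4 → ℕ) :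
    X r s j * mono r s b - lc r s j b • mono r s (b + δ j) ∈ F r s (deg b) := by
  obtain ⟨a, b, c, d, rfl⟩ : ∃ a b' c d, b = ![a, b', c, d] :=
    ⟨b 0, b 1, b 2, b 3, by ext i; fin_cases i <;> rfl⟩
  fin_cases j
  · have h' : ![a, b, c, d] + δ 0 = ![a + 1, b, c, d] := by ext i; fin_cases i <;> rfl
    have h'' : lc r s 0 ![a, b, c, d] = 1 := by simp [lc]
    have h : X r s 0 * mono r s ![a, b, c, d] = mono r s ![a + 1, b, c, d] := by
      rw [← psi_vec_eq_mono, ← psi_vec_eq_mono, X, Matrix.cons_val_zero, ← psi_op1, op1, op_vec]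
    simp [h, h', h'']
  · have h' : ![a, b, c, d] + δ 1 = ![a, b + 1, c, d] := by ext i; fin_cases i <;> rfl
    have h'' : lc r s 1 ![a, b, c, d] = (s ^ (2 * a))⁻¹ := by
      simp [lc, lam, expR, expS, pow_mul]
    have h : X r s 1 * mono r s ![a, b, c, d] =
        (s ^ (2 * a))⁻¹ • mono r s ![a, b + 1, c, d] := by
      rw [← psi_vec_eq_mono, ← psi_vec_eq_mono, X, Matrix.cons_val_one, Matrix.cons_val_zero, ← psi_op2 hs, op2,
        op_vec, map_smul]
    simp [h, h', h'']
  · have h' : ![a, b, c, d] + δ 2 = ![a, b, c + 1, d] := by ext i; fin_cases i <;> rfl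
    have h'' : lc r s 2 ![a, b, c, d] = (r ^ (2 * a) * s ^ (2 * a))⁻¹ * (r ^ b * s ^ b)⁻¹ := by
      simp [lc, Fin.prod_univ_four, lam, expR, expS, pow_mul, mul_pow,
        -mul_eq_mul_left_iff, -mul_eq_mul_right_iff]
      ring
    have h : X r s 2 * mono r s ![a, b, c, d] =
        ((r ^ (2 * a) * s ^ (2 * a))⁻¹ * (r ^ b * s ^ b)⁻¹) • mono r s ![a, b, c + 1, d] := by
      rw [← psi_vec_eq_mono, ← psi_vec_eq_mono, show X r s 2 = X3 r s from rfl, ← psi_op3 hr hs, op3, op_vec, map_smul]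
    simp [h, h', h'']
  · have h' : ![a, b, c, d] + δ 3 = ![a, b, c, d + 1] := by ext i; fin_cases i <;> rfl
    have h'' : lc r s 3 ![a, b, c, d] =
        (r ^ (2 * a))⁻¹ * (s ^ (2 * b))⁻¹ * (r ^ c * s ^ c)⁻¹ := by
      simp [lc, Fin.prod_univ_four, lam, expR, expS, pow_mul, mul_pow,
        -mul_eq_mul_left_iff, -mul_eq_mul_right_iff]
      ring
    have h : X r s 3 * mono r s ![a, b, c, d] =
        ((r ^ (2 * a))⁻¹ * (s ^ (2 * b))⁻¹ * (r ^ c * s ^ c)⁻¹) • mono r s ![a, b, c, d + 1]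
        + ((r ^ (2 * a))⁻¹ * coeff42 r s b) • mono r s ![a, b - 1, c + 1, d]
        + coeff41 r s a • mono r s ![a - 1, b + 1, c, d] := by
      simp only [← psi_vec_eq_mono]
      rw [show X r s 3 = X4 r s from rfl, ← psi_op4 hr hs, op4, op_vec]
      simp only [map_add, map_smul]
    have e : (fun i => i) (⟨3, by decide⟩ : Fin 4) = 3 := rfl
    rw [e, h, h', h'', add_assoc, add_sub_cancel_left]
    refine Submodule.add_mem _ ?_ ?_
    -- At `b = 0` the truncated exponent gives a monomial of too large a degree; it is the zero
    -- coefficient that removes it.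
    · rcases b with _ | b
      · simp [coeff42]
      · refine Submodule.smul_mem _ _ (mono_mem ?_)
        simp [deg, Fin.sum_univ_four]
        omega
    · rcases a with _ | a
      · simp [coeff41]
      · refine Submodule.smul_mem _ _ (mono_mem ?_)
        simp [deg, Fin.sum_univ_four]
        omega

end Filtration

/-! ### Products and leading coefficients. -/

section Filtration

variable {r s : ℂ}

theorem X_mul_mem (hr : r ≠ 0) (hs : s ≠ 0) (j : Fin 4) {n : ℕ} {u : U r s} (hu : u ∈ F r s n) :
    X r s j * u ∈ F r s (n + 1) := by
  have : F r s n ≤ (F r s (n + 1)).comap (LinearMap.mulLeft ℂ (X r s j)) := by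
    refine F_induction fun b hb => ?_
    have h := Submodule.add_mem _ (F_le (by omega : deg b ≤ n + 1) (X_mul_mono hr hs j b))
      (Submodule.smul_mem _ (lc r s j b)
        (mono_mem (r := r) (s := s) ((deg_add_δ b j).trans_le (Nat.succ_le_succ hb))))
    rwa [sub_add_cancel] at h
  exact this hu

theorem X_pow_mul_mem (hr : r ≠ 0) (hs : s ≠ 0) (j : Fin 4) (k : ℕ) {n : ℕ} {u : U r s}
    (hu : u ∈ F r s n) : X r s j ^ k * u ∈ F r s (k + n) := by
  induction k with
  | zero => simpa using hu
  | succ k ih =>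
    rw [pow_succ', mul_assoc, add_right_comm]
    exact X_mul_mem hr hs j ih

theorem mono_eq (b : Fin 4 → ℕ) : mono r s b =
    X r s 0 ^ b 0 * (X r s 1 ^ b 1 * (X r s 2 ^ b 2 * X r s 3 ^ b 3)) := rfl

theorem mul_mem_F (hr : r ≠ 0) (hs : s ≠ 0) {m n : ℕ} {u v : U r s} (hu : u ∈ F r s m)
    (hv : v ∈ F r s n) : u * v ∈ F r s (m + n) := by
  have : F r s m ≤ (F r s (m + n)).comap (LinearMap.mulRight ℂ v) := by
    refine F_induction fun b hb => ?_
    rw [Submodule.mem_comap, LinearMap.mulRight_apply, mono_eq]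
    simp only [mul_assoc]
    refine F_le ?_ (X_pow_mul_mem hr hs 0 (b 0) (X_pow_mul_mem hr hs 1 (b 1)
      (X_pow_mul_mem hr hs 2 (b 2) (X_pow_mul_mem hr hs 3 (b 3) hv))))
    simp only [deg, Fin.sum_univ_four] at hb
    omega
  exact this hu

theorem one_mem_F (n : ℕ) : (1 : U r s) ∈ F r s n := by
  have h := mono_mem (r := r) (s := s) (b := 0) (n := n)
    ((Finset.sum_eq_zero fun _ _ => rfl).trans_le (Nat.zero_le n))
  simpa [mono] using h

theorem X_mem_F (hr : r ≠ 0) (hs : s ≠ 0) (j : Fin 4) : X r s j ∈ F r s 1 := by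
  have h := X_mul_mem hr hs j (one_mem_F (r := r) (s := s) 0)
  rwa [mul_one] at h

theorem mono_δ (i : Fin 4) : mono r s (δ i) = X r s i := by
  fin_cases i <;> simp [mono, X]

/-- The correction being a multiple of one generator is what later bounds its image under a
derivation. -/
theorem exists_commutation (hr : r ≠ 0) (hs : s ≠ 0) (i j : Fin 4) :
    ∃ (c : ℂ) (k : Fin 4), X r s i * X r s j - lam r s i j • (X r s j * X r s i) = c • X r s k := by
  have key (i j : Fin 4) (h : i < j) : ∃ (c : ℂ) (k : Fin 4),
      X r s i * X r s j - lam r s i j • (X r s j * X r s i) = c • X r s k := by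
    have e12 := X1_mul_X2 (r := r) (s := s)
    have e13 := X1_mul_X3 (r := r) hs
    have e14 := X1_mul_X4 (r := r) (s := s)
    have e23 := X2_mul_X3 hr hs
    have e24 := X2_mul_X4 (r := r) hs
    have e34 := X3_mul_X4 (r := r) hs
    fin_cases i <;> fin_cases j <;> first | exact absurd h (by decide) | skip
    · exact ⟨0, 0, by simpa [X, lam, expR, expS, sub_eq_zero] using e12⟩
    · exact ⟨0, 0, by simpa [X, lam, expR, expS, sub_eq_zero] using e13⟩
    · exact ⟨1, 1, by simpa [X, lam, expR, expS, sub_eq_iff_eq_add'] using e14⟩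
    · exact ⟨0, 0, by simpa [X, lam, expR, expS, sub_eq_zero] using e23⟩
    · exact ⟨-s ^ 2, 2, by
        have h : lam r s 1 3 = s ^ 2 := by simp [lam, expR, expS]
        change X2 r s * X4 r s - lam r s 1 3 • (X4 r s * X2 r s) = _ • X3 r s
        rw [h, e24]
        module⟩
    · exact ⟨0, 0, by simpa [X, lam, expR, expS, sub_eq_zero] using e34⟩
  rcases lt_trichotomy i j with h | rfl | h
  · exact key i j h
  · exact ⟨0, 0, by simp [lam_self]⟩
  · obtain ⟨c, k, hk⟩ := key j i h
    refine ⟨-lam r s i j * c, k, ?_⟩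
    rw [mul_smul, ← hk, smul_sub, smul_smul, neg_mul, lam_mul_lam hr hs]
    module

theorem X_mul_X (hr : r ≠ 0) (hs : s ≠ 0) (i j : Fin 4) :
    X r s i * X r s j - lam r s i j • (X r s j * X r s i) ∈ F r s 1 := by
  obtain ⟨c, k, h⟩ := exists_commutation hr hs i j
  rw [h]
  exact Submodule.smul_mem _ _ (X_mem_F hr hs k)

/-- `u` has degree at most `m` and commutes with `X j` up to the factor `c` and lower terms. -/
def QComm (j : Fin 4) (u : U r s) (m : ℕ) (c : ℂ) : Prop :=
  u ∈ F r s m ∧ u * X r s j - c • (X r s j * u) ∈ F r s m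

theorem QComm.mul (hr : r ≠ 0) (hs : s ≠ 0) {j : Fin 4} {u v : U r s} {m n : ℕ} {c d : ℂ}
    (hu : QComm j u m c) (hv : QComm j v n d) : QComm j (u * v) (m + n) (c * d) := by
  refine ⟨mul_mem_F hr hs hu.1 hv.1, ?_⟩
  have : u * v * X r s j - (c * d) • (X r s j * (u * v)) =
      u * (v * X r s j - d • (X r s j * v)) + d • ((u * X r s j - c • (X r s j * u)) * v) := by
    simp only [mul_sub, sub_mul, mul_smul_comm, smul_mul_assoc, mul_assoc]
    module
  rw [this]
  exact Submodule.add_mem _ (mul_mem_F hr hs hu.1 hv.2)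
    (Submodule.smul_mem _ _ (mul_mem_F hr hs hu.2 hv.1))

theorem QComm.pow (hr : r ≠ 0) (hs : s ≠ 0) (i j : Fin 4) (k : ℕ) :
    QComm j (X r s i ^ k) k (lam r s i j ^ k) := by
  induction k with
  | zero => exact ⟨by simpa using one_mem_F 0, by simp⟩
  | succ k ih =>
    rw [pow_succ, pow_succ]
    exact ih.mul hr hs ⟨X_mem_F hr hs i, X_mul_X hr hs i j⟩

theorem mono_mul_X (hr : r ≠ 0) (hs : s ≠ 0) (j : Fin 4) (b : Fin 4 → ℕ) :
    mono r s b * X r s j - chi r s j b • (X r s j * mono r s b) ∈ F r s (deg b) := by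
  have h := (QComm.pow hr hs 0 j (b 0)).mul hr hs ((QComm.pow hr hs 1 j (b 1)).mul hr hs
    ((QComm.pow hr hs 2 j (b 2)).mul hr hs (QComm.pow hr hs 3 j (b 3))))
  have := h.2
  rw [← mono_eq] at this
  simpa only [chi, deg, Fin.prod_univ_four, Fin.sum_univ_four, mul_assoc, add_assoc] using this

/-- Leading coefficients of `X j * u`. -/
theorem co_X_mul (hr : r ≠ 0) (hs : s ≠ 0) (j : Fin 4) {n : ℕ} {u : U r s} (hu : u ∈ F r s n)
    {b : Fin 4 → ℕ} (hb : deg b = n) :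
    co hr hs (X r s j * u) (b + δ j) = lc r s j b * co hr hs u b := by
  have : F r s n ≤ LinearMap.eqLocus
      (Finsupp.lapply (b + δ j) ∘ₗ (co hr hs).toLinearMap ∘ₗ LinearMap.mulLeft ℂ (X r s j))
      (lc r s j b • (Finsupp.lapply b ∘ₗ (co hr hs).toLinearMap)) := by
    refine F_induction fun a ha => ?_
    have h := (mem_F_iff hr hs).1 (X_mul_mono hr hs j a) (b + δ j) (by rw [deg_add_δ]; omega)
    rw [map_sub, map_smul, Finsupp.sub_apply, sub_eq_zero, co_mono] at h
    simp only [LinearMap.mem_eqLocus, LinearMap.comp_apply, LinearMap.smul_apply,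
      LinearMap.mulLeft_apply, Finsupp.lapply_apply, LinearEquiv.coe_coe, h, co_mono]
    by_cases hab : a = b
    · simp [hab]
    · simp [hab]
  exact this hu

/-- In top degree, multiplication by `X j` only yields monomials divisible by `X j`. -/
theorem co_X_mul_eq_zero (hr : r ≠ 0) (hs : s ≠ 0) (j : Fin 4) {n : ℕ} {u : U r s}
    (hu : u ∈ F r s n) {b : Fin 4 → ℕ} (hb : deg b = n + 1) (hj : b j = 0) :
    co hr hs (X r s j * u) b = 0 := by
  have : F r s n ≤ LinearMap.ker
      (Finsupp.lapply b ∘ₗ (co hr hs).toLinearMap ∘ₗ LinearMap.mulLeft ℂ (X r s j)) := by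
    refine F_induction fun a ha => ?_
    have h := (mem_F_iff hr hs).1 (X_mul_mono hr hs j a) b (by omega)
    rw [map_sub, map_smul, Finsupp.sub_apply, sub_eq_zero, co_mono] at h
    simp only [LinearMap.mem_ker, LinearMap.comp_apply,
      LinearMap.mulLeft_apply, Finsupp.lapply_apply, LinearEquiv.coe_coe, h]
    have hab : a + δ j ≠ b := by
      rintro rfl
      simp at hj
    simp [hab]
  exact this hu

/-- Leading coefficients of `u * X j`. -/
theorem co_mul_X (hr : r ≠ 0) (hs : s ≠ 0) (j : Fin 4) {n : ℕ} {u : U r s} (hu : u ∈ F r s n)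
    {b : Fin 4 → ℕ} (hb : deg b = n) :
    co hr hs (u * X r s j) (b + δ j) = chi r s j b * (lc r s j b * co hr hs u b) := by
  have : F r s n ≤ LinearMap.eqLocus
      (Finsupp.lapply (b + δ j) ∘ₗ (co hr hs).toLinearMap ∘ₗ LinearMap.mulRight ℂ (X r s j))
      (chi r s j b • lc r s j b • (Finsupp.lapply b ∘ₗ (co hr hs).toLinearMap)) := by
    refine F_induction fun a ha => ?_
    have h := (mem_F_iff hr hs).1 (mono_mul_X hr hs j a) (b + δ j) (by rw [deg_add_δ]; omega)
    rw [map_sub, map_smul, Finsupp.sub_apply, sub_eq_zero, Finsupp.smul_apply,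
      co_X_mul hr hs j (mono_mem ha) hb, co_mono] at h
    simp only [LinearMap.mem_eqLocus, LinearMap.comp_apply, LinearMap.smul_apply,
      LinearMap.mulRight_apply, Finsupp.lapply_apply, LinearEquiv.coe_coe, h, co_mono]
    by_cases hab : a = b
    · simp [hab]
    · simp [hab]
  exact this hu

theorem co_mul_X_eq_zero (hr : r ≠ 0) (hs : s ≠ 0) (j : Fin 4) {n : ℕ} {u : U r s}
    (hu : u ∈ F r s n) {b : Fin 4 → ℕ} (hb : deg b = n + 1) (hj : b j = 0) :
    co hr hs (u * X r s j) b = 0 := by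
  have : F r s n ≤ LinearMap.ker
      (Finsupp.lapply b ∘ₗ (co hr hs).toLinearMap ∘ₗ LinearMap.mulRight ℂ (X r s j)) := by
    refine F_induction fun a ha => ?_
    have h := (mem_F_iff hr hs).1 (mono_mul_X hr hs j a) b (by omega)
    rw [map_sub, map_smul, Finsupp.sub_apply, sub_eq_zero, Finsupp.smul_apply,
      co_X_mul_eq_zero hr hs j (mono_mem ha) hb hj, smul_zero] at h
    exact h
  exact this hu

end Filtration

/-! ### Consequences of the independence of `r` and `s`. -/

section Derivation

variable {r s : ℂ}

theorem zpow_mul_zpow_eq_iff (hr : r ≠ 0) (hs : s ≠ 0)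
    (hrs : ∀ m n : ℤ, r ^ m * s ^ n = 1 → m = 0 ∧ n = 0) {a b c d : ℤ}
    (h : r ^ a * s ^ b = r ^ c * s ^ d) : a = c ∧ b = d := by
  have := hrs (a - c) (b - d) (by
    rw [zpow_sub₀ hr, zpow_sub₀ hs]
    have := zpow_ne_zero c hr
    have := zpow_ne_zero d hs
    field_simp
    exact h)
  omega

theorem chi_eq (hr : r ≠ 0) (hs : s ≠ 0) (j : Fin 4) (b : Fin 4 → ℕ) :
    chi r s j b = r ^ (∑ l, expR l j * b l) * s ^ (∑ l, expS l j * b l) := by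
  simp only [chi, lam, mul_pow, Fin.prod_univ_four, Fin.sum_univ_four, zpow_add₀ hr, zpow_add₀ hs,
    zpow_mul, zpow_natCast]
  ring

/-- Independence turns `chi j b = 1` for all `j` into linear equations in `b`, one for the exponent
of `r` and one for that of `s`; their only common solution is zero. -/
theorem exists_chi_ne_one (hr : r ≠ 0) (hs : s ≠ 0)
    (hrs : ∀ m n : ℤ, r ^ m * s ^ n = 1 → m = 0 ∧ n = 0) {b : Fin 4 → ℕ} (hb : b ≠ 0) :
    ∃ j, chi r s j b ≠ 1 := by
  by_contra! h
  have h' (j : Fin 4) := hrs _ _ (chi_eq hr hs j b ▸ h j)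
  have h0 := h' 0
  have h1 := h' 1
  have h2 := h' 2
  have h3 := h' 3
  simp [Fin.sum_univ_four, expR, expS] at h0 h1 h2 h3
  refine hb ?_
  ext i; fin_cases i <;> simp <;> omega

/-- Otherwise `Xᵇ Xᵢ⁻¹` would commute with every other generator of the quantum torus; for `b i = 0`
the resulting exponent equations are inconsistent. -/
theorem exists_chi_ne_lam (hr : r ≠ 0) (hs : s ≠ 0)
    (hrs : ∀ m n : ℤ, r ^ m * s ^ n = 1 → m = 0 ∧ n = 0) {b : Fin 4 → ℕ} {i : Fin 4}
    (hi : b i = 0) : ∃ j, j ≠ i ∧ chi r s j b ≠ lam r s i j := by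
  by_contra! h
  have h' (j : Fin 4) (hj : j ≠ i) :=
    zpow_mul_zpow_eq_iff hr hs hrs ((chi_eq hr hs j b).symm.trans (h j hj))
  have h0 := h' 0
  have h1 := h' 1
  have h2 := h' 2
  have h3 := h' 3
  fin_cases i <;> simp [Fin.sum_univ_four, expR, expS] at h0 h1 h2 h3 hi <;> omega

end Derivation

/-! ### Reduction of derivations modulo inner ones. -/

section Derivation

variable {r s : ℂ}

theorem der_mul (D : Der ℂ (U r s)) (a b : U r s) : D.1 (a * b) = D.1 a * b + a * D.1 b := D.2 a b

theorem ad_apply (t x : U r s) : (ad ℂ (U r s) t).1 x = t * x - x * t := rfl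

/-- Each product on the left may have degree `n + 1`, but the total is the image of a multiple of
one generator. Hence the parts of degree `n + 1` cancel. -/
theorem der_commutation_mem (hr : r ≠ 0) (hs : s ≠ 0) {D : Der ℂ (U r s)} {n : ℕ}
    (hD : ∀ i, D.1 (X r s i) ∈ F r s n) (i j : Fin 4) :
    D.1 (X r s i) * X r s j + X r s i * D.1 (X r s j)
      - lam r s i j • (D.1 (X r s j) * X r s i + X r s j * D.1 (X r s i)) ∈ F r s n := by
  obtain ⟨c, k, h⟩ := exists_commutation hr hs i j
  have h' := congrArg D.1 h
  rw [map_sub, map_smul, map_smul, der_mul, der_mul] at h'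
  rw [h']
  exact Submodule.smul_mem _ _ (hD k)

/-- The leading coefficients of a derivation at exponents not divisible by `X i` vanish. -/
theorem co_der_eq_zero (hr : r ≠ 0) (hs : s ≠ 0)
    (hrs : ∀ m n : ℤ, r ^ m * s ^ n = 1 → m = 0 ∧ n = 0) {D : Der ℂ (U r s)} {n : ℕ}
    (hD : ∀ i, D.1 (X r s i) ∈ F r s n) {i : Fin 4} {b : Fin 4 → ℕ} (hb : deg b = n)
    (hi : b i = 0) : co hr hs (D.1 (X r s i)) b = 0 := by
  obtain ⟨j, hj, hchi⟩ := exists_chi_ne_lam hr hs hrs hi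
  have hb' : deg (b + δ j) = n + 1 := by rw [deg_add_δ, hb]
  -- At `b + δ j` the terms with `D (X j)` drop out, since they are multiplied by `X i`.
  have hi' : (b + δ j) i = 0 := by simp [hi, hj.symm]
  have h := (mem_F_iff hr hs).1 (der_commutation_mem hr hs hD i j) (b + δ j) (by omega)
  simp only [map_sub, map_add, map_smul, Finsupp.sub_apply, Finsupp.add_apply, Finsupp.smul_apply,
    co_mul_X hr hs j (hD i) hb, co_X_mul hr hs j (hD i) hb,
    co_mul_X_eq_zero hr hs i (hD j) hb' hi', co_X_mul_eq_zero hr hs i (hD j) hb' hi',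
    smul_eq_mul] at h
  have h' : (chi r s j b - lam r s i j) * (lc r s j b * co hr hs (D.1 (X r s i)) b) = 0 := by
    linear_combination h
  simpa [sub_eq_zero, hchi, lc_ne_zero hr hs] using h'

/-- The compatibility of the leading coefficients of a derivation. -/
theorem co_der_compat (hr : r ≠ 0) (hs : s ≠ 0) {D : Der ℂ (U r s)} {n : ℕ}
    (hD : ∀ i, D.1 (X r s i) ∈ F r s (n + 1)) (i j : Fin 4) {a : Fin 4 → ℕ} (ha : deg a = n) :
    lc r s j a * (chi r s j a - 1) * co hr hs (D.1 (X r s i)) (a + δ i) =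
      lc r s i a * (chi r s i a - 1) * co hr hs (D.1 (X r s j)) (a + δ j) := by
  -- The identity is symmetric in `i` and `j`; fixing the order decides which of the two `lc`
  -- factors gains a `lam`.
  have key (i j : Fin 4) (hij : i < j) :
      lc r s j a * (chi r s j a - 1) * co hr hs (D.1 (X r s i)) (a + δ i) =
        lc r s i a * (chi r s i a - 1) * co hr hs (D.1 (X r s j)) (a + δ j) := by
    have hi : deg (a + δ i) = n + 1 := by rw [deg_add_δ, ha]
    have hj : deg (a + δ j) = n + 1 := by rw [deg_add_δ, ha]
    have h := (mem_F_iff hr hs).1 (der_commutation_mem hr hs hD i j) (a + δ i + δ j)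
      (by rw [deg_add_δ]; omega)
    have hswap : a + δ i + δ j = a + δ j + δ i := add_right_comm _ _ _
    simp only [map_sub, map_add, map_smul, Finsupp.sub_apply, Finsupp.add_apply,
      Finsupp.smul_apply, co_mul_X hr hs j (hD i) hi, co_X_mul hr hs j (hD i) hi, smul_eq_mul] at h
    rw [hswap, co_mul_X hr hs i (hD j) hj, co_X_mul hr hs i (hD j) hj, chi_add_δ, chi_add_δ,
      lc_add_δ, lc_add_δ, if_pos hij, if_neg hij.asymm] at h
    have hl := lam_mul_lam hr hs i j
    linear_combination h + (-(chi r s j a * lc r s j a * co hr hs (D.1 (X r s i)) (a + δ i))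
      + chi r s i a * lc r s i a * co hr hs (D.1 (X r s j)) (a + δ j)
      + lc r s j a * co hr hs (D.1 (X r s i)) (a + δ i)) * hl
  rcases lt_trichotomy i j with h | rfl | h
  · exact key i j h
  · rfl
  · exact (key j i h).symm

/-- Subtracting an inner derivation lowers the degree of a derivation of positive degree. -/
theorem exists_ad_lower (hr : r ≠ 0) (hs : s ≠ 0)
    (hrs : ∀ m n : ℤ, r ^ m * s ^ n = 1 → m = 0 ∧ n = 0) {D : Der ℂ (U r s)} {n : ℕ}
    (hn : n ≠ 0) (hD : ∀ i, D.1 (X r s i) ∈ F r s (n + 1)) :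
    ∃ t : U r s, ∀ i, (D - ad ℂ (U r s) t).1 (X r s i) ∈ F r s n := by
  -- The commutator of `c • mono a` with `X i` has exactly this leading coefficient, so `c` is the
  -- coefficient of `mono a` in the element sought. It is found by dividing at an index `j` with
  -- `chi j a ≠ 1`, which exists because `n ≠ 0` makes `a` nonzero; by `co_der_compat` it serves
  -- every `i`.
  have hex (a : Fin 4 → ℕ) : ∃ c : ℂ, deg a = n → ∀ i,
      co hr hs (D.1 (X r s i)) (a + δ i) = lc r s i a * (chi r s i a - 1) * c := by
    by_cases ha : deg a = n
    · obtain ⟨j, hj⟩ := exists_chi_ne_one hr hs hrs (b := a) (by rintro rfl; exact hn (ha.symm.trans (Finset.sum_eq_zero fun _ _ => rfl)))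
      have hj' := sub_ne_zero.2 hj
      have hl := lc_ne_zero hr hs j a
      refine ⟨co hr hs (D.1 (X r s j)) (a + δ j) / (lc r s j a * (chi r s j a - 1)), fun _ i => ?_⟩
      rw [mul_div_assoc', eq_div_iff (mul_ne_zero hl hj'), mul_comm]
      exact co_der_compat hr hs hD i j ha
    · exact ⟨0, fun h => absurd h ha⟩
  choose c hc using hex
  set t : U r s := ∑ a ∈ Finset.piAntidiag Finset.univ n, c a • mono r s a with ht
  have htF : t ∈ F r s n := by
    refine Submodule.sum_mem _ fun a ha => Submodule.smul_mem _ _ (mono_mem ?_)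
    exact (Finset.mem_piAntidiag.1 ha).1.le
  have hco (a : Fin 4 → ℕ) (ha : deg a = n) : co hr hs t a = c a := by
    rw [ht, map_sum, Finsupp.finsetSum_apply, Finset.sum_eq_single a]
    · simp [co_mono]
    · intro b _ hb
      simp [co_mono, hb]
    · intro h
      exact absurd (Finset.mem_piAntidiag.2 ⟨ha, by simp⟩) h
  have hval (i : Fin 4) : (D - ad ℂ (U r s) t).1 (X r s i) =
      D.1 (X r s i) - (t * X r s i - X r s i * t) := rfl
  have hmem (i : Fin 4) : (D - ad ℂ (U r s) t).1 (X r s i) ∈ F r s (n + 1) := by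
    rw [hval]
    exact Submodule.sub_mem _ (hD i) (Submodule.sub_mem _ (mul_mem_F hr hs htF (X_mem_F hr hs i))
      (X_mul_mem hr hs i htF))
  refine ⟨t, fun i => mem_F_of_lead hr hs (hmem i) fun b hb => ?_⟩
  -- Monomials not divisible by `X i` vanish for the corrected derivation as for any other; the
  -- divisible ones cancel by the choice of `t`.
  by_cases hi : b i = 0
  · exact co_der_eq_zero hr hs hrs hmem hb hi
  · obtain ⟨a, rfl⟩ : ∃ a, b = a + δ i :=
      ⟨b - δ i, (tsub_add_cancel_of_le (by
        intro l
        rcases eq_or_ne l i with rfl | hl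
        · simp; omega
        · simp [hl])).symm⟩
    have ha : deg a = n := by rw [deg_add_δ] at hb; omega
    rw [hval, map_sub, map_sub, Finsupp.sub_apply, Finsupp.sub_apply, hc a ha i,
      co_mul_X hr hs i htF ha, co_X_mul hr hs i htF ha, hco a ha]
    ring

theorem exists_ad_degree_one (hr : r ≠ 0) (hs : s ≠ 0)
    (hrs : ∀ m n : ℤ, r ^ m * s ^ n = 1 → m = 0 ∧ n = 0) (D : Der ℂ (U r s)) :
    ∃ t : U r s, ∀ i, (D - ad ℂ (U r s) t).1 (X r s i) ∈ F r s 1 := by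
  have key (n : ℕ) : ∀ D : Der ℂ (U r s), (∀ i, D.1 (X r s i) ∈ F r s (n + 1)) →
      ∃ t : U r s, ∀ i, (D - ad ℂ (U r s) t).1 (X r s i) ∈ F r s 1 := by
    induction n with
    | zero => exact fun D hD => ⟨0, by simpa using hD⟩
    | succ n ih =>
      intro D hD
      obtain ⟨t, ht⟩ := exists_ad_lower hr hs hrs n.succ_ne_zero hD
      obtain ⟨u, hu⟩ := ih _ ht
      refine ⟨t + u, ?_⟩
      rwa [map_add, ← sub_sub]
  choose m hm using fun i => exists_mem_F hr hs (D.1 (X r s i))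
  exact key (∑ i, m i) D fun i =>
    F_le ((Finset.single_le_sum (fun _ _ => Nat.zero_le _) (Finset.mem_univ i)).trans
      (Nat.le_succ _)) (hm i)

theorem mono_zero : mono r s 0 = 1 := by
  simp [mono]

theorem exists_eq_smul_one {u : U r s} (hu : u ∈ F r s 0) : ∃ c : ℂ, u = c • 1 := by
  have : F r s 0 ≤ Submodule.span ℂ {1} := by
    refine F_induction fun b hb => ?_
    have hb0 : b = 0 := by
      ext l
      rw [deg] at hb
      have := Finset.single_le_sum (f := b) (fun _ _ => Nat.zero_le _) (Finset.mem_univ l)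
      simp; omega
    rw [hb0, mono_zero]
    exact Submodule.mem_span_singleton_self 1
  obtain ⟨c, hc⟩ := Submodule.mem_span_singleton.1 (this hu)
  exact ⟨c, hc.symm⟩

/-- The only exponent of degree one divisible by `X i` is `δ i`, so by `co_der_eq_zero` no other
generator occurs in the image of `X i`. -/
theorem exists_diagonal (hr : r ≠ 0) (hs : s ≠ 0)
    (hrs : ∀ m n : ℤ, r ^ m * s ^ n = 1 → m = 0 ∧ n = 0) {D : Der ℂ (U r s)}
    (hD : ∀ i, D.1 (X r s i) ∈ F r s 1) (i : Fin 4) :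
    ∃ m c : ℂ, D.1 (X r s i) = m • X r s i + c • 1 := by
  have h0 : D.1 (X r s i) - co hr hs (D.1 (X r s i)) (δ i) • X r s i ∈ F r s 0 := by
    refine mem_F_of_lead hr hs (Submodule.sub_mem _ (hD i)
      (Submodule.smul_mem _ _ (X_mem_F hr hs i))) fun b hb => ?_
    rw [map_sub, map_smul, ← mono_δ i, co_mono, mono_δ, Finsupp.sub_apply, Finsupp.smul_apply]
    by_cases hi : b i = 0
    · rw [co_der_eq_zero hr hs hrs hD hb hi, Finsupp.single_eq_of_ne (by rintro rfl; simp at hi)]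
      simp
    · have hbi : b = δ i := by
        have hsum := Finset.add_sum_erase Finset.univ b (Finset.mem_univ i)
        rw [deg] at hb
        ext l
        rcases eq_or_ne l i with rfl | hl
        · simp; omega
        · have := Finset.single_le_sum (f := b) (fun _ _ => Nat.zero_le _)
            (Finset.mem_erase.2 ⟨hl, Finset.mem_univ l⟩)
          simp [hl]; omega
      simp [hbi]
  obtain ⟨c, hc⟩ := exists_eq_smul_one h0
  exact ⟨_, c, sub_eq_iff_eq_add'.1 hc⟩

theorem der_eq_of_generators {D E : Der ℂ (U r s)} (h1 : D.1 (X1 r s) = E.1 (X1 r s))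
    (h4 : D.1 (X4 r s) = E.1 (X4 r s)) : D = E := by
  have h0 (D : Der ℂ (U r s)) : D.1 1 = 0 := by
    have := der_mul D 1 1
    simpa using this
  refine Subtype.ext (LinearMap.ext fun u => ?_)
  induction u using U_induction with
  | algebraMap c => rw [Algebra.algebraMap_eq_smul_one, map_smul, map_smul, h0, h0]
  | e1 => exact h1
  | e2 => exact h4
  | mul u v hu hv => rw [der_mul, der_mul, hu, hv]
  | add u v hu hv => rw [map_add, map_add, hu, hv]

theorem X_linearIndependent (hr : r ≠ 0) (hs : s ≠ 0) {c : Fin 4 → ℂ} {d : ℂ}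
    (h : ∑ i, c i • X r s i + d • 1 = 0) (i : Fin 4) : c i = 0 := by
  have h' := congrArg (fun u => co hr hs u (δ i)) h
  simp only [← mono_δ, ← mono_zero, map_add, map_sum, map_smul, co_mono, Finsupp.add_apply,
    Finsupp.finsetSum_apply, Finsupp.smul_apply, map_zero, Finsupp.zero_apply] at h'
  rw [Finset.sum_eq_single i, Finsupp.single_eq_same, Finsupp.single_eq_of_ne] at h'
  · simpa using h'
  · intro h0
    simpa using congrFun h0 i
  · intro j _ hj
    rw [Finsupp.single_eq_of_ne, smul_zero]
    intro h0
    have := congrFun h0 j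
    simp [hj] at this
  · simp

theorem exists_ad_add_diag (hr : r ≠ 0) (hs : s ≠ 0)
    (hrs : ∀ m n : ℤ, r ^ m * s ^ n = 1 → m = 0 ∧ n = 0) (D : Der ℂ (U r s)) :
    ∃ (t : U r s) (μ₁ μ₂ : ℂ), D = ad ℂ (U r s) t + μ₁ • D1 r s + μ₂ • D2 r s := by
  obtain ⟨t, ht⟩ := exists_ad_degree_one hr hs hrs D
  set E := D - ad ℂ (U r s) t with hE
  obtain ⟨m₁, c₁, h₁⟩ := exists_diagonal hr hs hrs ht 0
  obtain ⟨m₂, c₂, h₂⟩ := exists_diagonal hr hs hrs ht 1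
  obtain ⟨m₄, c₄, h₄⟩ := exists_diagonal hr hs hrs ht 3
  simp only [show X r s 0 = X1 r s from rfl, show X r s 1 = X2 r s from rfl,
    show X r s 3 = X4 r s from rfl] at h₁ h₂ h₄
  have hX2 : X2 r s = X1 r s * X4 r s - r ^ 2 • (X4 r s * X1 r s) := rfl
  have h := congrArg E.1 hX2
  rw [map_sub, map_smul, der_mul, der_mul, h₁, h₂, h₄] at h
  -- This is `E` applied to the definition of `X2`, with everything moved to one side. The image of
  -- `X3` is not needed, since `X1` and `X4` generate.
  have hrel : ∑ i, ![(r ^ 2 - 1) * c₄, m₂ - m₁ - m₄, 0, (r ^ 2 - 1) * c₁] i • X r s i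
      + c₂ • (1 : U r s) = 0 := by
    rw [← sub_eq_zero] at h
    rw [← h]
    simp only [Fin.sum_univ_four, X, hX2, Matrix.cons_val, add_mul, mul_add, smul_mul_assoc,
      mul_smul_comm, one_mul, mul_one]
    module
  have hr2 : r ^ 2 - 1 ≠ 0 := by
    intro h2
    have := hrs 2 0 (by rw [zpow_zero, mul_one]; exact_mod_cast sub_eq_zero.1 h2)
    omega
  have hc₄ : c₄ = 0 := by
    have := X_linearIndependent hr hs hrel 0
    simpa [hr2] using this
  have hc₁ : c₁ = 0 := by
    have := X_linearIndependent hr hs hrel 3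
    simpa [hr2] using this
  refine ⟨t, m₁, m₄, ?_⟩
  rw [add_assoc, ← sub_eq_iff_eq_add', ← hE]
  have hval (x : U r s) : (m₁ • D1 r s + m₄ • D2 r s).1 x =
      m₁ • (D1 r s).1 x + m₄ • (D2 r s).1 x := rfl
  apply der_eq_of_generators
  · rw [h₁, hc₁, hval, D1, D2, diagDer_X1, diagDer_X1]
    simp
  · rw [h₄, hc₄, hval, D1, D2, diagDer_X4, diagDer_X4]
    simp

end Derivation

/-! ### Uniqueness of the scalars and the dimension of `HH1`. -/

section Uniqueness

variable {r s : ℂ}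

/-- The homomorphism `U → ℂ[x]` with `e₁ ↦ a x`, `e₂ ↦ b x`, where `a b = 0`. -/
noncomputable def toPoly (r s a b : ℂ) (hab : a * b = 0) : U r s →ₐ[ℂ] Polynomial ℂ :=
  RingQuot.liftAlgHom ℂ ⟨FreeAlgebra.lift ℂ
    ![Polynomial.C a * Polynomial.X, Polynomial.C b * Polynomial.X], by
    have h : Polynomial.C a * Polynomial.C b = 0 := by
      rw [← Polynomial.C_mul, hab, Polynomial.C_0]
    rintro _ _ (⟨x, y, rfl, rfl⟩ | ⟨x, y, rfl, rfl⟩) <;>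
      simp only [map_add, map_sub, map_smul, map_mul, map_pow, map_zero,
        FreeAlgebra.lift_ι_apply, Matrix.cons_val_zero, Matrix.cons_val_one,
        Polynomial.smul_eq_C_mul]
    · linear_combination (1 - (Polynomial.C r ^ 2 + Polynomial.C s ^ 2)
        + Polynomial.C r ^ 2 * Polynomial.C s ^ 2) * Polynomial.C a * Polynomial.X ^ 3 * h
    · linear_combination (1 - (Polynomial.C r ^ 2 + Polynomial.C r * Polynomial.C s
          + Polynomial.C s ^ 2)
        + Polynomial.C r * Polynomial.C s * (Polynomial.C r ^ 2 + Polynomial.C r * Polynomial.C s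
          + Polynomial.C s ^ 2)
        - Polynomial.C r ^ 3 * Polynomial.C s ^ 3) * Polynomial.C b ^ 2 * Polynomial.X ^ 4 * h⟩

theorem toPoly_e1 (a b : ℂ) (hab : a * b = 0) :
    toPoly r s a b hab (e1 r s) = Polynomial.C a * Polynomial.X := by
  simp [toPoly, e1]

theorem toPoly_e2 (a b : ℂ) (hab : a * b = 0) :
    toPoly r s a b hab (e2 r s) = Polynomial.C b * Polynomial.X := by
  simp [toPoly, e2]

theorem toPoly_ad (a b : ℂ) (hab : a * b = 0) (t x : U r s) :
    toPoly r s a b hab ((ad ℂ (U r s) t).1 x) = 0 := by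
  rw [ad_apply, map_sub, map_mul, map_mul, mul_comm, sub_self]

/-- Evaluate at `X1` and map by `e₁ ↦ x`, `e₂ ↦ 0`: the commutator dies and `μ₁ x = 0` remains.
Exchanging the roles of `e₁` and `e₂` gives `μ₂`. -/
theorem diag_coeff_eq_zero {I : Der ℂ (U r s)} (hI : I ∈ InnDer ℂ (U r s)) {μ₁ μ₂ : ℂ}
    (h : I + μ₁ • D1 r s + μ₂ • D2 r s = 0) : μ₁ = 0 ∧ μ₂ = 0 := by
  obtain ⟨t, rfl⟩ := hI
  have hval (x : U r s) : (ad ℂ (U r s) t).1 x + μ₁ • (D1 r s).1 x + μ₂ • (D2 r s).1 x = 0 :=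
    congrArg (fun D : Der ℂ (U r s) => D.1 x) h
  constructor
  · have h1 := congrArg (toPoly r s 1 0 (mul_zero 1)) (hval (X1 r s))
    rw [D1, D2, diagDer_X1, diagDer_X1, map_add, map_add, toPoly_ad, X1] at h1
    simpa [toPoly_e1] using h1
  · have h4 := congrArg (toPoly r s 0 1 (zero_mul 1)) (hval (X4 r s))
    rw [D1, D2, diagDer_X4, diagDer_X4, map_add, map_add, toPoly_ad, X4] at h4
    simpa [toPoly_e2] using h4

theorem existsUnique_decomposition (hr : r ≠ 0) (hs : s ≠ 0)
    (hrs : ∀ m n : ℤ, r ^ m * s ^ n = 1 → m = 0 ∧ n = 0) (D : Der ℂ (U r s)) :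
    ∃! p : InnDer ℂ (U r s) × ℂ × ℂ,
      D = (p.1 : Der ℂ (U r s)) + p.2.1 • D1 r s + p.2.2 • D2 r s := by
  obtain ⟨t, μ₁, μ₂, h⟩ := exists_ad_add_diag hr hs hrs D
  refine ⟨(⟨ad ℂ (U r s) t, t, rfl⟩, μ₁, μ₂), h, ?_⟩
  rintro ⟨I, ν₁, ν₂⟩ hI
  have hsub : ((I : Der ℂ (U r s)) - ad ℂ (U r s) t) + (ν₁ - μ₁) • D1 r s
      + (ν₂ - μ₂) • D2 r s = 0 := by
    have h' := h.symm.trans hI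
    simp only at h'
    linear_combination (norm := module) -h'
  obtain ⟨h1, h2⟩ := diag_coeff_eq_zero (Submodule.sub_mem _ I.2 ⟨t, rfl⟩) hsub
  rw [h1, h2, zero_smul, zero_smul, add_zero, add_zero, sub_eq_zero] at hsub
  exact Prod.ext (Subtype.ext hsub) (Prod.ext (sub_eq_zero.1 h1) (sub_eq_zero.1 h2))

theorem span_HH1 (hr : r ≠ 0) (hs : s ≠ 0)
    (hrs : ∀ m n : ℤ, r ^ m * s ^ n = 1 → m = 0 ∧ n = 0) :
    Submodule.span ℂ {(InnDer ℂ (U r s)).mkQ (D1 r s), (InnDer ℂ (U r s)).mkQ (D2 r s)} = ⊤ := by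
  refine eq_top_iff.2 fun x _ => ?_
  obtain ⟨D, rfl⟩ := Submodule.mkQ_surjective _ x
  obtain ⟨t, μ₁, μ₂, h⟩ := exists_ad_add_diag hr hs hrs D
  have ht : (InnDer ℂ (U r s)).mkQ (ad ℂ (U r s) t) = 0 :=
    (Submodule.Quotient.mk_eq_zero _).2 ⟨t, rfl⟩
  rw [h, map_add, map_add, ht, zero_add, map_smul, map_smul]
  exact Submodule.mem_span_pair.2 ⟨μ₁, μ₂, rfl⟩

theorem finrank_HH1 (hr : r ≠ 0) (hs : s ≠ 0)
    (hrs : ∀ m n : ℤ, r ^ m * s ^ n = 1 → m = 0 ∧ n = 0) :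
    Module.finrank ℂ (HH1 ℂ (U r s)) = 2 := by
  have hli : LinearIndependent ℂ
      ![(InnDer ℂ (U r s)).mkQ (D1 r s), (InnDer ℂ (U r s)).mkQ (D2 r s)] := by
    refine LinearIndependent.pair_iff.2 fun μ₁ μ₂ h => ?_
    rw [← map_smul, ← map_smul, ← map_add] at h
    have hmem : μ₁ • D1 r s + μ₂ • D2 r s ∈ InnDer ℂ (U r s) :=
      (Submodule.Quotient.mk_eq_zero _).1 h
    -- The combination is itself inner, so its negative serves as the inner summand.
    exact diag_coeff_eq_zero (Submodule.neg_mem _ hmem) (by module)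
  have hspan := span_HH1 hr hs hrs
  have := finrank_span_eq_card hli
  rw [Matrix.range_cons_cons_empty, hspan, finrank_top] at this
  simpa using this

end Uniqueness

end UPlusB2

theorem mainTheorem1 (r s : ℂ) (hr : r ≠ 0) (hs : s ≠ 0)
    (hrs : ∀ m n : ℤ, r ^ m * s ^ n = 1 → m = 0 ∧ n = 0) :
    -- the values of the derivations `D₁`, `D₂` on `X₁, X₂, X₃, X₄`
    ((UPlusB2.D1 r s).1 (UPlusB2.X1 r s) = UPlusB2.X1 r s ∧
      (UPlusB2.D1 r s).1 (UPlusB2.X2 r s) = UPlusB2.X2 r s ∧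
      (UPlusB2.D1 r s).1 (UPlusB2.X3 r s) = UPlusB2.X3 r s ∧
      (UPlusB2.D1 r s).1 (UPlusB2.X4 r s) = 0 ∧
      (UPlusB2.D2 r s).1 (UPlusB2.X1 r s) = 0 ∧
      (UPlusB2.D2 r s).1 (UPlusB2.X2 r s) = UPlusB2.X2 r s ∧
      (UPlusB2.D2 r s).1 (UPlusB2.X3 r s) = (2 : ℂ) • UPlusB2.X3 r s ∧
      (UPlusB2.D2 r s).1 (UPlusB2.X4 r s) = UPlusB2.X4 r s) ∧
    -- every derivation is `ad t + μ₁ D₁ + μ₂ D₂` for some `t`, `μ₁`, `μ₂`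
    (∀ D : Der ℂ (UPlusB2.U r s), ∃ (t : UPlusB2.U r s) (μ₁ μ₂ : ℂ),
      D = ad ℂ (UPlusB2.U r s) t + μ₁ • UPlusB2.D1 r s + μ₂ • UPlusB2.D2 r s) ∧
    -- with the inner derivation and the scalars uniquely determined
    (∀ D : Der ℂ (UPlusB2.U r s), ∃! p : InnDer ℂ (UPlusB2.U r s) × ℂ × ℂ,
      D = (p.1 : Der ℂ (UPlusB2.U r s)) + p.2.1 • UPlusB2.D1 r s + p.2.2 • UPlusB2.D2 r s) ∧
    -- `HH¹` is two-dimensional, spanned by the classes of `D₁` and `D₂`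
    Module.finrank ℂ (HH1 ℂ (UPlusB2.U r s)) = 2 ∧
    Submodule.span ℂ {(InnDer ℂ (UPlusB2.U r s)).mkQ (UPlusB2.D1 r s),
      (InnDer ℂ (UPlusB2.U r s)).mkQ (UPlusB2.D2 r s)} = ⊤ := by
  refine ⟨⟨?_, ?_, ?_, ?_, ?_, ?_, ?_, ?_⟩, UPlusB2.exists_ad_add_diag hr hs hrs,
    UPlusB2.existsUnique_decomposition hr hs hrs, UPlusB2.finrank_HH1 hr hs hrs,
    UPlusB2.span_HH1 hr hs hrs⟩
  · simp [UPlusB2.D1, UPlusB2.diagDer_X1]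
  · simp [UPlusB2.D1, UPlusB2.diagDer_X2]
  · simp [UPlusB2.D1, UPlusB2.diagDer_X3]
  · simp [UPlusB2.D1, UPlusB2.diagDer_X4]
  · simp [UPlusB2.D2, UPlusB2.diagDer_X1]
  · simp [UPlusB2.D2, UPlusB2.diagDer_X2]
  · simp [UPlusB2.D2, UPlusB2.diagDer_X3]
  · simp [UPlusB2.D2, UPlusB2.diagDer_X4]
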